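/- Let $\rho = 1+\sqrt2$ be the silver ratio and let $\alpha_t = \rho^{\nu(t+1)-1}+1$ ($t = 0,1,2,\dots$) be the silver stepsizes, where $\nu(i)$ is the largest integer $j$ such that $2^j$ divides $i$. For $M>0$ and $k \ge 1$, let $\alpha^{M,k}_t = \frac{1}{M}\,\alpha_{t \bmod (2^k-1)}$ be the silver stepsizes normalized by $1/M$ and restarted every $2^k-1$ iterations. There is a universal constant $C>0$ such that the following holds. For all $0 < m \le M$, with $\kappa = M/m$, there is an integer $k\ge 1$ such that the stepsizes $\alpha^{M,k}_t$ are all positive and, for every $R \ge 0$ and every $\varepsilon>0$, there is a number of iterations $$ n \;\le\; C\,\kappa^{\log_\rho 2}\,\max\{1, \log(R/\varepsilon)\} $$ (where $\log(R/\varepsilon)$ is read as non-positive if $R=0$) for which proximal gradient descent satisfies $\|x_n - x_*\| \le \varepsilon$ on every problem instance with $\|x_0-x_*\| \le R$. Precisely: for every dimension $d$, every $m$-strongly convex and $M$-smooth function $f:\mathbb{R}^d\to\mathbb{R}$ (i.e. $f$ is differentiable with $M$-Lipschitz gradient), every proper convex function $h:\mathbb{R}^d\to(-\infty,+\infty]$,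 every minimizer $x_*$ of $F=f+h$, and all points $x_0,\dots,x_n \in \mathbb{R}^d$ such that $\|x_0 - x_*\| \le R$ and $$ x_{t+1} = \operatorname{prox}_{\alpha^{M,k}_t h}\bigl(x_t - \alpha^{M,k}_t\nabla f(x_t)\bigr) \quad (0\le t<n), \qquad \operatorname{prox}_{\alpha h}(y) = \arg\min_{z}\Bigl\{ h(z) + \tfrac{1}{2\alpha}\|z-y\|^2\Bigr\}, $$ one has $\|x_n - x_*\| \le \varepsilon$. (Here $\|\cdot\|$ is the Euclidean norm.) -/

import Mathlib

/-- The silver ratio `ρ = 1 + √2`. -/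
noncomputable def silverRatio : ℝ := 1 + Real.sqrt 2

/-- The (normalized) silver stepsizes `α_t = ρ^(ν(t+1) - 1) + 1`, with `ν` the 2-adic valuation.
The exponent is an integer, equal to `-1` for even `t`. -/
noncomputable def silverStep (t : ℕ) : ℝ :=
  silverRatio ^ ((padicValNat 2 (t + 1) : ℤ) - 1) + 1

/-- Silver stepsizes for `M`-smooth functions, restarted every `2 ^ k - 1` iterations:
the first `2 ^ k - 1` silver stepsizes, normalized by `1 / M`, are repeated periodically. -/
noncomputable def restartedSilverStep (M : ℝ) (k : ℕ) (t : ℕ) : ℝ :=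
  silverStep (t % (2 ^ k - 1)) / M

/-- `f` is `M`-smooth: it is differentiable and its gradient is `M`-Lipschitz. -/
def IsSmooth {d : ℕ} (M : ℝ) (f : EuclideanSpace ℝ (Fin d) → ℝ) : Prop :=
  Differentiable ℝ f ∧ ∀ x y, ‖gradient f x - gradient f y‖ ≤ M * ‖x - y‖

/-- `h` is a proper convex extended-real-valued function: it never takes the value `-∞`, it is
finite somewhere, and its epigraph is convex. -/
structure IsProperConvex {d : ℕ} (h : EuclideanSpace ℝ (Fin d) → EReal) : Prop where
  ne_bot : ∀ x, h x ≠ ⊥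
  exists_ne_top : ∃ x, h x ≠ ⊤
  convex_epigraph : Convex ℝ {p : EuclideanSpace ℝ (Fin d) × ℝ | h p.1 ≤ (p.2 : EReal)}

/-- `z = prox_{α h}(y)`: the point `z` minimizes `h(z) + ‖z - y‖² / (2 α)`. -/
def IsProx {d : ℕ} (h : EuclideanSpace ℝ (Fin d) → EReal) (α : ℝ)
    (y z : EuclideanSpace ℝ (Fin d)) : Prop :=
  IsMinOn (fun w => h w + ((1 / (2 * α) * ‖w - y‖ ^ 2 : ℝ) : EReal)) Set.univ z

/-- `x 0, …, x n` are iterates of proximal gradient descent on `f + h` with stepsizes `α`: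
`x (t + 1) = prox_{α_t h}(x t - α_t ∇f(x t))` for all `t < n`. -/
def IsProximalGD {d : ℕ} (f : EuclideanSpace ℝ (Fin d) → ℝ)
    (h : EuclideanSpace ℝ (Fin d) → EReal) (α : ℕ → ℝ) (n : ℕ)
    (x : ℕ → EuclideanSpace ℝ (Fin d)) : Prop :=
  ∀ t < n, IsProx h (α t) (x t - α t • gradient f (x t)) (x (t + 1))

/-- `xs` is a minimizer of the composite objective `F = f + h`. -/
def IsCompositeMinimizer {d : ℕ} (f : EuclideanSpace ℝ (Fin d) → ℝ)
    (h : EuclideanSpace ℝ (Fin d) → EReal) (xs : EuclideanSpace ℝ (Fin d)) : Prop :=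
  IsMinOn (fun w => (f w : EReal) + h w) Set.univ xs

/-! ### The silver ratio and the silver stepsizes -/

/-! One restart period halves the distance to the minimizer. A block of `2 ^ k - 1` silver steps
from any point gives `ρ ^ k * (F(x_end) - F(x_*)) ≤ M * ‖x_start - x_*‖ ^ 2`
(`IsSilverBlock.objective_le`). Strong convexity bounds the objective gap below by `m / 2 * ‖x_end -
x_*‖ ^ 2`, so `ρ ^ k ≥ 8 κ` suffices for halving. The least such `k` makes the period of order `κ ^
(log_ρ 2)`, and about `log₂ (R / ε)` periods are enough.

The rate of a block comes from `IsSilverBlock.certificate`, an inequality relative to an arbitrary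
reference point, proved by induction on `k`. A block of level `k + 1` consists of a left block
ending at `y`, one long step to `w`, and a right block ending at `z`. The induction hypothesis is
used for the left block relative to the reference, and for the right block relative to the
reference, to `y` and to `z`, with weights `1`, `ρ`, `ρ`. Since `1 + 2 ρ = ρ ^ 2`, these and a few
cocoercivity and subgradient inequalities add up to the next certificate (`silver_glue`). The
nonsmooth part enters through the gaps `silverGap`: those relative to `y` share one lower bound `K`
(`le_silverGap`), so only their total weights matter. -/

theorem silverRatio_sq : silverRatio ^ 2 = 2 * silverRatio + 1 := by
  have := Real.sq_sqrt (show (0 : ℝ) ≤ 2 by norm_num)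
  unfold silverRatio
  linear_combination this

theorem two_lt_silverRatio : 2 < silverRatio := by
  have : (1 : ℝ) < √2 := Real.lt_sqrt_of_sq_lt (by norm_num)
  unfold silverRatio
  linarith

theorem silverRatio_pos : 0 < silverRatio := by linarith [two_lt_silverRatio]

theorem one_lt_silverStep (t : ℕ) : 1 < silverStep t := by
  have := zpow_pos silverRatio_pos ((padicValNat 2 (t + 1) : ℤ) - 1)
  unfold silverStep
  linarith

theorem silverStep_two_pow_sub_one (k : ℕ) :
    silverStep (2 ^ k - 1) = silverRatio ^ k / silverRatio + 1 := by
  have h : 2 ^ k - 1 + 1 = 2 ^ k := Nat.sub_add_cancel Nat.one_le_two_pow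
  rw [silverStep, h, padicValNat.prime_pow, zpow_sub_one₀ silverRatio_pos.ne', zpow_natCast,
    div_eq_mul_inv]

/-- Self-similarity of the schedule: adding `2 ^ k` to a positive integer below `2 ^ k` does not
change its 2-adic valuation. The two halves around the long step are therefore the same block. -/
theorem silverStep_two_pow_add {k t : ℕ} (ht : t < 2 ^ k - 1) :
    silverStep (2 ^ k + t) = silverStep t := by
  have hk : ¬ 2 ^ k ∣ t + 1 := fun h => by
    have := Nat.le_of_dvd (by omega) h
    omega
  have : padicValNat 2 (2 ^ k + (t + 1)) = padicValNat 2 (t + 1) := by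
    refine eq_of_forall_le_iff fun j => ?_
    rw [← padicValNat_dvd_iff_le (by positivity), ← padicValNat_dvd_iff_le (by omega)]
    rcases le_total j k with hj | hj
    · exact Nat.dvd_add_right (pow_dvd_pow 2 hj)
    · exact iff_of_false
        (fun h => hk ((Nat.dvd_add_right dvd_rfl).1 ((pow_dvd_pow 2 hj).trans h)))
        (fun h => hk ((pow_dvd_pow 2 hj).trans h))
  rw [silverStep, silverStep, add_assoc, this]

theorem sum_range_two_pow_succ_sub_one {A : Type*} [AddCommMonoid A] (k : ℕ) (u : ℕ → A) :
    ∑ t ∈ Finset.range (2 ^ (k + 1) - 1), u t =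
      ∑ t ∈ Finset.range (2 ^ k - 1), u t +
        (u (2 ^ k - 1) + ∑ t ∈ Finset.range (2 ^ k - 1), u (2 ^ k + t)) := by
  have h1 : 2 ^ (k + 1) - 1 = (2 ^ k - 1 + 1) + (2 ^ k - 1) := by
    have := Nat.one_le_two_pow (n := k)
    rw [pow_succ]; omega
  have h2 : 2 ^ k - 1 + 1 = 2 ^ k := Nat.sub_add_cancel Nat.one_le_two_pow
  rw [h1, Finset.sum_range_add, Finset.sum_range_succ, h2, add_assoc]

/-! ### Weighted sums along a block of silver steps -/

/-- `∑ t < 2 ^ k - 1, α_t φ (o + t)` for the silver stepsizes `α`. -/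
noncomputable def silverSum (k o : ℕ) (φ : ℕ → ℝ) : ℝ :=
  ∑ t ∈ Finset.range (2 ^ k - 1), silverStep t * φ (o + t)

/-- The weights with which the certificate of a block of `2 ^ k - 1` silver steps couples the
subgradients of the nonsmooth part to the last gradient of the smooth part. -/
noncomputable def silverTail : ℕ → ℕ → (ℕ → ℝ) → ℝ
  | 0, _, _ => 0
  | k + 1, o, φ =>
    silverRatio ^ 2 * silverTail k (o + 2 ^ k) φ +
      silverRatio * (silverStep (2 ^ k - 1) * φ (o + (2 ^ k - 1)) + silverSum k (o + 2 ^ k) φ)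

theorem silverSum_succ (k o : ℕ) (φ : ℕ → ℝ) :
    silverSum (k + 1) o φ =
      silverSum k o φ +
        (silverStep (2 ^ k - 1) * φ (o + (2 ^ k - 1)) + silverSum k (o + 2 ^ k) φ) := by
  unfold silverSum
  rw [sum_range_two_pow_succ_sub_one]
  congr 2
  refine Finset.sum_congr rfl fun t ht => ?_
  rw [silverStep_two_pow_add (Finset.mem_range.1 ht), add_assoc]

theorem silverSum_mono {k o : ℕ} {φ ψ : ℕ → ℝ} (h : ∀ t < 2 ^ k - 1, φ (o + t) ≤ ψ (o + t)) :
    silverSum k o φ ≤ silverSum k o ψ :=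
  Finset.sum_le_sum fun t ht =>
    mul_le_mul_of_nonneg_left (h t (Finset.mem_range.1 ht)) (by linarith [one_lt_silverStep t])

theorem silverSum_const (k o : ℕ) (c : ℝ) :
    silverSum k o (fun _ => c) = (silverRatio ^ k - 1) * c := by
  induction k generalizing o with
  | zero => simp [silverSum]
  | succ k ih =>
    rw [silverSum_succ, ih, ih, silverStep_two_pow_sub_one]
    have h := silverRatio_pos.ne'
    field_simp
    linear_combination -(c * silverRatio ^ k) * silverRatio_sq

theorem silverTail_mono {k o : ℕ} {φ ψ : ℕ → ℝ} (h : ∀ t < 2 ^ k - 1, φ (o + t) ≤ ψ (o + t)) :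
    silverTail k o φ ≤ silverTail k o ψ := by
  induction k generalizing o with
  | zero => exact le_rfl
  | succ k ih =>
    have hk : 2 ^ (k + 1) = 2 ^ k + 2 ^ k := by ring
    have hpos := Nat.one_le_two_pow (n := k)
    have h2 : ∀ t < 2 ^ k - 1, φ (o + 2 ^ k + t) ≤ ψ (o + 2 ^ k + t) := fun t ht => by
      rw [add_assoc]; exact h _ (by omega)
    have h1 := one_lt_silverStep (2 ^ k - 1)
    have h3 := h (2 ^ k - 1) (by omega)
    have hρ := silverRatio_pos.le
    unfold silverTail
    have h4 := ih h2
    have h5 := silverSum_mono h2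
    gcongr

/-- Total mass of the tail weights; with `silverSum_const` it turns a uniform lower bound on the
gaps into one on their weighted sums. -/
theorem silverTail_const (k o : ℕ) (c : ℝ) :
    silverTail k o (fun _ => c) = silverRatio ^ k * (silverRatio ^ k - 1) * c := by
  induction k generalizing o with
  | zero => simp [silverTail]
  | succ k ih =>
    rw [silverTail, ih, silverSum_const, silverStep_two_pow_sub_one]
    have h := silverRatio_pos.ne'
    field_simp
    linear_combination -(c * silverRatio ^ k) * silverRatio_sq

/-! ### Gluing two blocks of silver steps -/

section Gluing

variable {E : Type*} [NormedAddCommGroup E] [InnerProductSpace ℝ E]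

/-- The data of a block of `2 ^ k - 1` proximal gradient steps with silver stepsizes, starting at
index `o`: iterates `x`, gradients `g` and values `f` of the smooth part, subgradients `s` and
values `h` of the nonsmooth part. At the starting point of the block only the linearization of the
nonsmooth part from the next iterate is required. -/
structure IsSilverBlock (k o : ℕ) (x g s : ℕ → E) (f h : ℕ → ℝ) : Prop where
  step : ∀ t < 2 ^ k - 1, x (o + t + 1) = x (o + t) - silverStep t • (g (o + t) + s (o + t + 1))
  cocoercive : ∀ i j, o ≤ i → i < o + 2 ^ k → o ≤ j → j < o + 2 ^ k →
    f j + inner ℝ (g j) (x i - x j) + ‖g i - g j‖ ^ 2 / 2 ≤ f i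
  subgradient : ∀ i j, o ≤ i → i < o + 2 ^ k → o < j → j < o + 2 ^ k → (o < i ∨ j = o + 1) →
    h j + inner ℝ (s j) (x i - x j) ≤ h i

theorem IsSilverBlock.left {k o : ℕ} {x g s : ℕ → E} {f h : ℕ → ℝ}
    (H : IsSilverBlock (k + 1) o x g s f h) : IsSilverBlock k o x g s f h := by
  have hk : 2 ^ (k + 1) = 2 ^ k + 2 ^ k := by ring
  exact ⟨fun t ht => H.step t (by omega),
    fun i j h1 h2 h3 h4 => H.cocoercive i j h1 (by omega) h3 (by omega),
    fun i j h1 h2 h3 h4 => H.subgradient i j h1 (by omega) h3 (by omega)⟩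

theorem IsSilverBlock.right {k o : ℕ} {x g s : ℕ → E} {f h : ℕ → ℝ}
    (H : IsSilverBlock (k + 1) o x g s f h) : IsSilverBlock k (o + 2 ^ k) x g s f h := by
  have hk : 2 ^ (k + 1) = 2 ^ k + 2 ^ k := by ring
  have hpos := Nat.one_le_two_pow (n := k)
  refine ⟨fun t ht => ?_,
    fun i j h1 h2 h3 h4 => H.cocoercive i j (by omega) (by omega) (by omega) (by omega),
    fun i j h1 h2 h3 h4 _ => H.subgradient i j (by omega) (by omega) (by omega) (by omega)
      (Or.inl (by omega))⟩
  have := H.step (2 ^ k + t) (by omega)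
  rwa [silverStep_two_pow_add ht, ← add_assoc] at this

/-- For a reference point `xr` with gradient `gr` and nonsmooth value `hr`: twice the gap of the
linearization of the nonsmooth part at `x`, plus the squared norm of the total subgradient. -/
noncomputable def silverGap (xr gr : E) (hr : ℝ) (x s : E) (h : ℝ) : ℝ :=
  ‖s + gr‖ ^ 2 + 2 * (hr - h - inner ℝ s (xr - x))

/-- The algebraic identity behind the gluing of two blocks `x₀, …, y` and `w, …, z` of silver
steps, with `r = ρ ^ k` and `b = u + 1` the step from `y` to `w`. -/
theorem silver_glue {ρ u b r A T Sr Sy Sz C₁ C₂ fr ηr fy ηy ηw fz ηz K : ℝ}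
    {xr gr y gy w sw z gz : E} (hρ : ρ ^ 2 = 2 * ρ + 1) (hρ0 : 0 ≤ ρ) (hu : 0 ≤ u)
    (hr : r = ρ * u) (hb : b = u + 1) (hw : w = y - b • (gy + sw))
    (hK : b * K = b * (‖gy‖ ^ 2 - ‖sw‖ ^ 2) - 2 * (ηw - ηy))
    (h₁ : ‖y - (gy - gr) - xr‖ ^ 2 + 2 * r * (fy + ηy - (fr + ηr)) + T + C₁ ≤ A)
    (h₂ : ‖z - (gz - gr) - xr‖ ^ 2 + 2 * r * (fz + ηz - (fr + ηr)) + Sr + C₂ ≤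
      ‖w - xr‖ ^ 2 + 2 * (ηw + inner ℝ gr (w - xr) - ηr))
    (h₃ : ‖z - (gz - gy) - y‖ ^ 2 + 2 * r * (fz + ηz - (fy + ηy)) + Sy + C₂ ≤
      ‖w - y‖ ^ 2 + 2 * (ηw + inner ℝ gy (w - y) - ηy))
    (h₄ : ‖z - (gz - gz) - z‖ ^ 2 + 2 * r * (fz + ηz - (fz + ηz)) + Sz + C₂ ≤
      ‖w - z‖ ^ 2 + 2 * (ηw + inner ℝ gz (w - z) - ηz))
    (hC : r * (r - 1) * K ≤ C₁) (hS : (r - 1) * K ≤ Sy)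
    (hQz : fy + inner ℝ gy (z - y) + ‖gz - gy‖ ^ 2 / 2 ≤ fz)
    (hQr : fy + inner ℝ gy (xr - y) + ‖gr - gy‖ ^ 2 / 2 ≤ fr)
    (hP : ηw + inner ℝ sw (y - w) ≤ ηy) :
    ‖z - (gz - gr) - xr‖ ^ 2 + 2 * (ρ * r) * (fz + ηz - (fr + ηr)) +
        (T + (b * silverGap xr gr ηr w sw ηw + Sr)) +
        (ρ ^ 2 * C₂ + ρ * (b * silverGap z gz ηz w sw ηw + Sz)) ≤ A := by
  have hr0 : 0 ≤ r := hr ▸ mul_nonneg hρ0 hu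
  have h₃' := mul_le_mul_of_nonneg_left h₃ hρ0
  have h₄' := mul_le_mul_of_nonneg_left h₄ hρ0
  have hS' := mul_le_mul_of_nonneg_left hS hρ0
  have hQz' := mul_le_mul_of_nonneg_left hQz hr0
  have hQr' := mul_le_mul_of_nonneg_left hQr hu
  have hP' := mul_le_mul_of_nonneg_left hP hr0
  -- The slack of the conclusion is a nonnegative combination of the slacks of the hypotheses.
  suffices key : A - (‖z - (gz - gr) - xr‖ ^ 2 + 2 * (ρ * r) * (fz + ηz - (fr + ηr)) +
        (T + (b * silverGap xr gr ηr w sw ηw + Sr)) +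
        (ρ ^ 2 * C₂ + ρ * (b * silverGap z gz ηz w sw ηw + Sz))) =
      (A - (‖y - (gy - gr) - xr‖ ^ 2 + 2 * r * (fy + ηy - (fr + ηr)) + T + C₁)) +
      (‖w - xr‖ ^ 2 + 2 * (ηw + inner ℝ gr (w - xr) - ηr) -
        (‖z - (gz - gr) - xr‖ ^ 2 + 2 * r * (fz + ηz - (fr + ηr)) + Sr + C₂)) +
      (ρ * (‖w - y‖ ^ 2 + 2 * (ηw + inner ℝ gy (w - y) - ηy)) -
        ρ * (‖z - (gz - gy) - y‖ ^ 2 + 2 * r * (fz + ηz - (fy + ηy)) + Sy + C₂)) +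
      (ρ * (‖w - z‖ ^ 2 + 2 * (ηw + inner ℝ gz (w - z) - ηz)) -
        ρ * (‖z - (gz - gz) - z‖ ^ 2 + 2 * r * (fz + ηz - (fz + ηz)) + Sz + C₂)) +
      (C₁ - r * (r - 1) * K) + (ρ * Sy - ρ * ((r - 1) * K)) +
      2 * (r * fz - r * (fy + inner ℝ gy (z - y) + ‖gz - gy‖ ^ 2 / 2)) +
      2 * (u * fr - u * (fy + inner ℝ gy (xr - y) + ‖gr - gy‖ ^ 2 / 2)) +
      2 * (r * ηy - r * (ηw + inner ℝ sw (y - w))) by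
    linarith
  -- `e` is the cofactor of `ρ ^ 2 - 2 * ρ - 1` in the identity, named before the inner products are
  -- expanded. The total weight of `K` is `(r - 1) * (r + ρ) = ρ * (r - 1) * b`, so `hK` eliminates
  -- it without division.
  obtain ⟨e, he⟩ : ∃ e, e = 2 * u * (fy - fr - inner ℝ gr (y - xr)) +
      2 * u * (ηw - ηr + inner ℝ gr (w - xr)) +
      b * u * (‖sw + gr‖ ^ 2 - ‖gy - gr‖ ^ 2) + C₂ :=
    ⟨_, rfl⟩
  subst hw hr hb
  simp only [silverGap, ← real_inner_self_eq_norm_sq, inner_sub_left, inner_sub_right,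
    inner_add_left, inner_add_right, real_inner_smul_left, real_inner_smul_right,
    real_inner_comm y xr, real_inner_comm y gr, real_inner_comm y gy, real_inner_comm y sw,
    real_inner_comm y z, real_inner_comm y gz, real_inner_comm xr gr, real_inner_comm xr gy,
    real_inner_comm xr sw, real_inner_comm xr z, real_inner_comm xr gz, real_inner_comm gr gy,
    real_inner_comm gr sw, real_inner_comm gr z, real_inner_comm gr gz, real_inner_comm gy sw,
    real_inner_comm gy z, real_inner_comm gy gz, real_inner_comm sw z, real_inner_comm sw gz,
    real_inner_comm z gz] at hK he ⊢
  linear_combination (ρ * (ρ * u - 1)) * hK - e * hρ + (ρ ^ 2 - 2 * ρ - 1) * he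

/-- The gap relative to `y` is bounded below using the linearizations at both ends of a step. -/
theorem le_silverGap {b K hy hw h : ℝ} {y gy w sw x s : E} (hb : 1 ≤ b)
    (hw' : w = y - b • (gy + sw))
    (hK : b * K = b * (‖gy‖ ^ 2 - ‖sw‖ ^ 2) - 2 * (hw - hy))
    (hy' : h + inner ℝ s (y - x) ≤ hy) (hw'' : h + inner ℝ s (w - x) ≤ hw) :
    K ≤ silverGap y gy hy x s h := by
  -- `b * (gap - K)` is `2 * (b - 1)` times the slack at `y`, plus twice the slack at `w`, plus `b *
  -- ‖s - sw‖ ^ 2`.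
  have h1 : 0 ≤ (b - 1) * (hy - h - inner ℝ s (y - x)) :=
    mul_nonneg (by linarith) (by linarith)
  have h2 : 0 ≤ b * ‖s - sw‖ ^ 2 := by positivity
  refine le_of_mul_le_mul_left ?_ (by linarith : 0 < b)
  subst hw'
  simp only [silverGap, ← real_inner_self_eq_norm_sq, inner_sub_left, inner_sub_right,
    inner_add_left, inner_add_right, real_inner_smul_right, real_inner_comm gy s,
    real_inner_comm sw s] at *
  nlinarith

/-- The certificate for `2 ^ k - 1` proximal gradient steps with silver stepsizes, relative to an
arbitrary reference point. -/
theorem IsSilverBlock.certificate {k o : ℕ} {x g s : ℕ → E} {f h : ℕ → ℝ}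
    (H : IsSilverBlock k o x g s f h) (xr gr : E) (fr hr : ℝ)
    (hQ : ∀ i, o ≤ i → i < o + 2 ^ k →
      f i + inner ℝ (g i) (xr - x i) + ‖gr - g i‖ ^ 2 / 2 ≤ fr) :
    ‖x (o + (2 ^ k - 1)) - (g (o + (2 ^ k - 1)) - gr) - xr‖ ^ 2 +
        2 * silverRatio ^ k * (f (o + (2 ^ k - 1)) + h (o + (2 ^ k - 1)) - (fr + hr)) +
        silverSum k o (fun t => silverGap xr gr hr (x (t + 1)) (s (t + 1)) (h (t + 1))) +
        silverTail k o (fun t => silverGap (x (o + (2 ^ k - 1))) (g (o + (2 ^ k - 1)))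
          (h (o + (2 ^ k - 1))) (x (t + 1)) (s (t + 1)) (h (t + 1))) ≤
      ‖x o - xr‖ ^ 2 + 2 * (h o + inner ℝ gr (x o - xr) - hr) := by
  induction k generalizing o xr gr fr hr with
  | zero =>
    have h0 := hQ o le_rfl (by simp)
    simp only [silverTail, silverSum, pow_zero, Nat.sub_self, Finset.range_zero,
      Finset.sum_empty, add_zero, ← real_inner_self_eq_norm_sq, inner_sub_left, inner_sub_right,
      real_inner_comm (x o) (g o), real_inner_comm (x o) gr, real_inner_comm (x o) xr,
      real_inner_comm (g o) gr, real_inner_comm (g o) xr, real_inner_comm xr gr] at h0 ⊢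
    linarith
  | succ k ih =>
    have hk : 2 ^ (k + 1) = 2 ^ k + 2 ^ k := by ring
    have hpos := Nat.one_le_two_pow (n := k)
    have hyw : o + (2 ^ k - 1) + 1 = o + 2 ^ k := by omega
    have hz : o + (2 ^ (k + 1) - 1) = o + 2 ^ k + (2 ^ k - 1) := by omega
    have hb1 := one_lt_silverStep (2 ^ k - 1)
    have hstep := H.step (2 ^ k - 1) (by omega)
    have ih₁ := ih H.left xr gr fr hr fun i h1 h2 => hQ i h1 (by omega)
    have ih₂ := ih H.right xr gr fr hr fun i h1 h2 => hQ i (by omega) (by omega)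
    have ih₃ := ih H.right (x (o + (2 ^ k - 1))) (g (o + (2 ^ k - 1))) (f (o + (2 ^ k - 1)))
      (h (o + (2 ^ k - 1)))
      fun i h1 h2 => H.cocoercive _ i (by omega) (by omega) (by omega) (by omega)
    have ih₄ := ih H.right (x (o + 2 ^ k + (2 ^ k - 1))) (g (o + 2 ^ k + (2 ^ k - 1)))
      (f (o + 2 ^ k + (2 ^ k - 1))) (h (o + 2 ^ k + (2 ^ k - 1)))
      fun i h1 h2 => H.cocoercive _ i (by omega) (by omega) (by omega) (by omega)
    have hQz := H.cocoercive (o + 2 ^ k + (2 ^ k - 1)) (o + (2 ^ k - 1)) (by omega) (by omega)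
      (by omega) (by omega)
    have hQr := hQ (o + (2 ^ k - 1)) (by omega) (by omega)
    have hP := H.subgradient (o + (2 ^ k - 1)) (o + 2 ^ k) (by omega) (by omega) (by omega)
      (by omega) (by omega)
    rw [hyw] at hstep
    rw [hz, silverSum_succ, silverTail, hyw, pow_succ' silverRatio]
    obtain ⟨K, hK⟩ : ∃ K, silverStep (2 ^ k - 1) * K =
        silverStep (2 ^ k - 1) * (‖g (o + (2 ^ k - 1))‖ ^ 2 - ‖s (o + 2 ^ k)‖ ^ 2) -
          2 * (h (o + 2 ^ k) - h (o + (2 ^ k - 1))) :=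
      ⟨_, mul_div_cancel₀ _ (by linarith)⟩
    -- The last condition says `k ≥ 1`: for `k = 0`, `y` is the starting point, where only one
    -- linearization is known, but then both sums are empty.
    have hgap : ∀ j, o < j → j < o + 2 ^ (k + 1) → j ≠ o + 2 ^ k → o < o + (2 ^ k - 1) →
        K ≤ silverGap (x (o + (2 ^ k - 1))) (g (o + (2 ^ k - 1))) (h (o + (2 ^ k - 1)))
          (x j) (s j) (h j) := by
      intro j hj1 hj2 hj3 hj4
      have p₁ := H.subgradient (o + (2 ^ k - 1)) j (by omega) (by omega) hj1 hj2 (Or.inl hj4)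
      have p₂ := H.subgradient (o + 2 ^ k) j (by omega) (by omega) hj1 hj2 (Or.inl (by omega))
      exact le_silverGap hb1.le hstep hK p₁ p₂
    refine silver_glue (u := silverRatio ^ k / silverRatio) silverRatio_sq silverRatio_pos.le
      (div_nonneg (pow_nonneg silverRatio_pos.le _) silverRatio_pos.le)
      (mul_div_cancel₀ _ silverRatio_pos.ne').symm (silverStep_two_pow_sub_one k) hstep hK
      ih₁ ih₂ ih₃ ih₄ ?_ ?_ hQz hQr hP
    · rw [← silverTail_const k o K]
      exact silverTail_mono fun t ht => hgap _ (by omega) (by omega) (by omega) (by omega)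
    · rw [← silverSum_const k (o + 2 ^ k) K]
      exact silverSum_mono fun t ht => hgap _ (by omega) (by omega) (by omega) (by omega)

/-- A full block of silver steps, started at an arbitrary point, bounds the final objective gap. -/
theorem IsSilverBlock.objective_le {k o : ℕ} {x g s : ℕ → E} {f h : ℕ → ℝ} (hk : 1 ≤ k)
    (hstep : ∀ t < 2 ^ k - 1, x (o + t + 1) = x (o + t) - silverStep t • (g (o + t) + s (o + t + 1)))
    (hQ : ∀ i j, f j + inner ℝ (g j) (x i - x j) + ‖g i - g j‖ ^ 2 / 2 ≤ f i)
    (hP : ∀ i j, o < i → i < o + 2 ^ k → o < j → j < o + 2 ^ k →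
      h j + inner ℝ (s j) (x i - x j) ≤ h i)
    {xr gr : E} {fr hr : ℝ}
    (hQr : ∀ i, f i + inner ℝ (g i) (xr - x i) + ‖gr - g i‖ ^ 2 / 2 ≤ fr)
    (hPr : ∀ i, o < i → i < o + 2 ^ k → h i + inner ℝ (s i) (xr - x i) ≤ hr) :
    silverRatio ^ k * (f (o + (2 ^ k - 1)) + h (o + (2 ^ k - 1)) - (fr + hr)) ≤
      ‖x o - xr‖ ^ 2 := by
  have hpos : 1 < 2 ^ k := Nat.one_lt_two_pow (by omega)
  have hn : o < o + (2 ^ k - 1) := by omega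
  -- The starting point may lie outside the domain of the nonsmooth part. Its value is replaced by
  -- the linearization from the next iterate, the smallest value that `IsSilverBlock` admits.
  set h' := Function.update h o (h (o + 1) + inner ℝ (s (o + 1)) (x o - x (o + 1))) with hh'
  have h_of_lt : ∀ i, o < i → h' i = h i := fun i hi => Function.update_of_ne hi.ne' _ _
  have h_start : h' o = h (o + 1) + inner ℝ (s (o + 1)) (x o - x (o + 1)) :=
    Function.update_self ..
  have H : IsSilverBlock k o x g s f h' := by
    refine ⟨hstep, fun i j _ _ _ _ => hQ i j, fun i j hi hi' hj hj' hij => ?_⟩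
    rcases hi.eq_or_lt with rfl | hi
    · obtain rfl : j = o + 1 := by omega
      rw [h_start, h_of_lt _ hj]
    · rw [h_of_lt _ hi, h_of_lt _ hj]
      exact hP i j hi hi' hj hj'
  have cert := H.certificate xr gr fr hr fun i _ _ => hQr i
  have hsum : ‖s (o + 1) + gr‖ ^ 2 ≤
      silverSum k o (fun t => silverGap xr gr hr (x (t + 1)) (s (t + 1)) (h' (t + 1))) := by
    have hnonneg : ∀ t < 2 ^ k - 1, ‖s (o + t + 1) + gr‖ ^ 2 ≤
        silverGap xr gr hr (x (o + t + 1)) (s (o + t + 1)) (h' (o + t + 1)) := fun t ht => by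
      have := hPr (o + t + 1) (by omega) (by omega)
      rw [silverGap, h_of_lt _ (by omega)]
      linarith
    have hstep0 := one_lt_silverStep 0
    calc ‖s (o + 1) + gr‖ ^ 2
        ≤ silverStep 0 * silverGap xr gr hr (x (o + 0 + 1)) (s (o + 0 + 1)) (h' (o + 0 + 1)) := by
          have := hnonneg 0 (by omega)
          rw [add_zero] at this ⊢
          nlinarith [sq_nonneg ‖s (o + 1) + gr‖]
      _ ≤ _ := Finset.single_le_sum (f := fun t => silverStep t *
            silverGap xr gr hr (x (o + t + 1)) (s (o + t + 1)) (h' (o + t + 1)))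
          (fun t ht => mul_nonneg (by linarith [one_lt_silverStep t])
            ((sq_nonneg _).trans (hnonneg t (Finset.mem_range.1 ht)))) (Finset.mem_range.2 (by omega))
  have htail : 0 ≤ silverTail k o (fun t => silverGap (x (o + (2 ^ k - 1))) (g (o + (2 ^ k - 1)))
      (h' (o + (2 ^ k - 1))) (x (t + 1)) (s (t + 1)) (h' (t + 1))) := by
    have h0 := silverTail_const k o 0
    rw [mul_zero] at h0
    rw [← h0]
    refine silverTail_mono fun t ht => ?_
    have := hP (o + (2 ^ k - 1)) (o + t + 1) hn (by omega) (by omega) (by omega)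
    rw [silverGap, h_of_lt _ hn, h_of_lt _ (by omega)]
    linarith [sq_nonneg ‖s (o + t + 1) + g (o + (2 ^ k - 1))‖]
  -- The right side of the certificate exceeds `‖x o - xr‖ ^ 2` by at most `2 * inner ℝ (s (o + 1) +
  -- gr) (x o - xr)`. By AM-GM this costs another `‖x o - xr‖ ^ 2` and a `‖s (o + 1) + gr‖ ^ 2` that
  -- `hsum` absorbs.
  have hend := hPr (o + 1) (by omega) (by omega)
  have hcs := real_inner_le_norm (s (o + 1) + gr) (x o - xr)
  have hamgm := sq_nonneg (‖s (o + 1) + gr‖ - ‖x o - xr‖)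
  have hfin := sq_nonneg ‖x (o + (2 ^ k - 1)) - (g (o + (2 ^ k - 1)) - gr) - xr‖
  rw [h_of_lt _ hn] at htail
  rw [h_of_lt _ hn, h_start] at cert
  simp only [inner_sub_right, inner_add_left] at cert hend hcs
  nlinarith

end Gluing

open Set Filter Topology

/-! ### Convexity and smoothness -/

theorem nonneg_of_hasDerivAt_of_le {u : ℝ → ℝ} {u' : ℝ} (hu : HasDerivAt u u' 0)
    (h : ∀ t ∈ Set.Ioo (0 : ℝ) 1, u 0 ≤ u t) : 0 ≤ u' := by
  have := (hasDerivWithinAt_iff_tendsto_slope' (s := Set.Ioi (0 : ℝ)) (by simp)).1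
    hu.hasDerivWithinAt
  refine ge_of_tendsto this ?_
  filter_upwards [Ioo_mem_nhdsGT (zero_lt_one (α := ℝ))] with t ht
  rw [slope_def_field, sub_zero]
  exact div_nonneg (sub_nonneg.2 (h t ht)) ht.1.le

section Smooth

variable {E : Type*} [NormedAddCommGroup E] [InnerProductSpace ℝ E] [CompleteSpace E]

theorem HasGradientAt.hasDerivAt_line {φ : E → ℝ} {v z d : E} {t : ℝ}
    (hφ : HasGradientAt φ v (z + t • d)) :
    HasDerivAt (fun r : ℝ => φ (z + r • d)) (inner ℝ v d) t := by
  have h1 : HasDerivAt (fun r : ℝ => z + r • d) d t := by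
    simpa using ((hasDerivAt_id t).smul_const d).const_add z
  exact hφ.hasFDerivAt.comp_hasDerivAt t h1

theorem StrongConvexOn.add_inner_gradient_le {m : ℝ} {f : E → ℝ} (hf : StrongConvexOn Set.univ m f)
    (hd : Differentiable ℝ f) (x y : E) :
    f x + inner ℝ (gradient f x) (y - x) + m / 2 * ‖y - x‖ ^ 2 ≤ f y := by
  have h1 : HasDerivAt (fun t : ℝ => f (x + t • (y - x))) (inner ℝ (gradient f x) (y - x)) 0 :=
    HasGradientAt.hasDerivAt_line (by simpa using (hd _).hasGradientAt)
  have h2 : HasDerivAt (fun t : ℝ => t * (f y - f x) - t * (1 - t) * (m / 2 * ‖y - x‖ ^ 2))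
      (f y - f x - m / 2 * ‖y - x‖ ^ 2) 0 := by
    have h3 := hasDerivAt_id (0 : ℝ)
    refine ((h3.mul_const (f y - f x)).fun_sub
      ((h3.fun_mul (h3.const_sub 1)).mul_const (m / 2 * ‖y - x‖ ^ 2))).congr_deriv ?_
    simp
  have := nonneg_of_hasDerivAt_of_le (h2.sub h1) fun t ht => by
    have := hf.2 (Set.mem_univ x) (Set.mem_univ y) (sub_nonneg.2 ht.2.le) ht.1.le (by ring)
    rw [show (1 - t) • x + t • y = x + t • (y - x) by module, norm_sub_rev] at this
    simp only [smul_eq_mul] at this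
    simp
    nlinarith
  linarith

theorem le_add_inner_gradient_of_lipschitz {M : ℝ} {f : E → ℝ} (hd : Differentiable ℝ f)
    (hL : ∀ x y, ‖gradient f x - gradient f y‖ ≤ M * ‖x - y‖) (x y : E) :
    f y ≤ f x + inner ℝ (gradient f x) (y - x) + M / 2 * ‖y - x‖ ^ 2 := by
  have hderiv : ∀ t : ℝ, HasDerivAt (fun t : ℝ => f (x + t • (y - x)) -
      t * inner ℝ (gradient f x) (y - x) - t ^ 2 * (M / 2 * ‖y - x‖ ^ 2))
      (inner ℝ (gradient f (x + t • (y - x))) (y - x) - inner ℝ (gradient f x) (y - x) -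
        2 * t * (M / 2 * ‖y - x‖ ^ 2)) t := fun t => by
    have h1 := HasGradientAt.hasDerivAt_line (d := y - x) (hd (x + t • (y - x))).hasGradientAt
    refine ((h1.fun_sub ((hasDerivAt_id t).mul_const (inner ℝ (gradient f x) (y - x)))).fun_sub
      (((hasDerivAt_id t).fun_pow 2).mul_const (M / 2 * ‖y - x‖ ^ 2))).congr_deriv ?_
    rw [one_mul, pow_one, mul_one, id_eq, Nat.cast_ofNat]
  have hanti := antitoneOn_of_deriv_nonpos (convex_Icc (0 : ℝ) 1)
    (fun t _ => (hderiv t).continuousAt.continuousWithinAt)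
    (fun t _ => (hderiv t).differentiableAt.differentiableWithinAt) fun t ht => by
      rw [interior_Icc] at ht
      rw [(hderiv t).deriv, ← inner_sub_left]
      have h1 := real_inner_le_norm (gradient f (x + t • (y - x)) - gradient f x) (y - x)
      have h2 := hL (x + t • (y - x)) x
      rw [add_sub_cancel_left, norm_smul, Real.norm_of_nonneg ht.1.le] at h2
      nlinarith [mul_le_mul_of_nonneg_right h2 (norm_nonneg (y - x))]
  have := hanti (Set.left_mem_Icc.2 zero_le_one) (Set.right_mem_Icc.2 zero_le_one) zero_le_one
  norm_num only [one_smul, zero_smul, add_zero, add_sub_cancel] at this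
  linarith

/-- The convexity lower bound from `x` and the smoothness upper bound from `y` are compared at `y -
(1 / M) • (gradient f y - gradient f x)`. -/
theorem add_inner_gradient_add_le {M : ℝ} (hM : 0 < M) {f : E → ℝ} (hd : Differentiable ℝ f)
    (hL : ∀ x y, ‖gradient f x - gradient f y‖ ≤ M * ‖x - y‖)
    (hc : ∀ x y, f x + inner ℝ (gradient f x) (y - x) ≤ f y) (x y : E) :
    f x + inner ℝ (gradient f x) (y - x) + ‖gradient f y - gradient f x‖ ^ 2 / (2 * M) ≤ f y := by
  have h1 := hc x (y - (1 / M) • (gradient f y - gradient f x))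
  have h2 := le_add_inner_gradient_of_lipschitz hd hL y
    (y - (1 / M) • (gradient f y - gradient f x))
  have h3 := real_inner_self_eq_norm_sq (gradient f y - gradient f x)
  rw [sub_sub_cancel_left, norm_neg, norm_smul, inner_neg_right, real_inner_smul_right,
    Real.norm_of_nonneg (by positivity)] at h2
  rw [sub_right_comm, inner_sub_right, real_inner_smul_right] at h1
  have h4 : 1 / M * inner ℝ (gradient f y) (gradient f y - gradient f x) -
      1 / M * inner ℝ (gradient f x) (gradient f y - gradient f x) =
      1 / M * ‖gradient f y - gradient f x‖ ^ 2 := by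
    rw [← mul_sub, ← inner_sub_left, h3]
  have h5 : M / 2 * (1 / M * ‖gradient f y - gradient f x‖) ^ 2 =
      ‖gradient f y - gradient f x‖ ^ 2 / (2 * M) := by field_simp
  have h6 : 1 / M * ‖gradient f y - gradient f x‖ ^ 2 =
      2 * (‖gradient f y - gradient f x‖ ^ 2 / (2 * M)) := by field_simp
  linarith

end Smooth

/-! ### Subgradients of the nonsmooth part -/

section Subgradient

variable {d : ℕ} {h : EuclideanSpace ℝ (Fin d) → EReal}

/-- The first-order optimality condition: if `z` minimizes `h + φ` with `φ` differentiable at `z`,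
then `-∇φ z` is a subgradient of `h` at `z`. -/
theorem IsProperConvex.subgradient_of_isMin (hh : IsProperConvex h)
    {φ : EuclideanSpace ℝ (Fin d) → ℝ} {v z : EuclideanSpace ℝ (Fin d)}
    (hφ : HasGradientAt φ v z) (hmin : ∀ w, h z + (φ z : EReal) ≤ h w + (φ w : EReal)) :
    h z ≠ ⊤ ∧ ∀ w, h w ≠ ⊤ → (h z).toReal - inner ℝ v (w - z) ≤ (h w).toReal := by
  have hz : h z ≠ ⊤ := by
    obtain ⟨w, hw⟩ := hh.exists_ne_top
    intro hz
    have := hmin w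
    lift h w to ℝ using ⟨hw, hh.ne_bot w⟩ with b
    rw [hz, EReal.top_add_coe, ← EReal.coe_add, top_le_iff] at this
    exact EReal.coe_ne_top _ this
  refine ⟨hz, fun w hw => ?_⟩
  have hza : h z = ((h z).toReal : EReal) := (EReal.coe_toReal hz (hh.ne_bot z)).symm
  have hwa : h w = ((h w).toReal : EReal) := (EReal.coe_toReal hw (hh.ne_bot w)).symm
  set a := (h z).toReal
  set b := (h w).toReal
  have h1 : HasDerivAt (fun t : ℝ => φ (z + t • (w - z))) (inner ℝ v (w - z)) 0 :=
    HasGradientAt.hasDerivAt_line (by simpa using hφ)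
  have h2 : HasDerivAt (fun t : ℝ => t * (b - a)) (b - a) 0 := by
    simpa using (hasDerivAt_id (0 : ℝ)).mul_const (b - a)
  -- Convexity replaces `h` on the segment by its chord, so the minimality at `z` becomes a
  -- one-sided derivative condition on a differentiable function.
  have := nonneg_of_hasDerivAt_of_le (h1.add h2) fun t ht => by
    have hmem := hh.convex_epigraph (x := (z, a)) (by exact hza.le) (y := (w, b)) (by exact hwa.le)
      (sub_nonneg.2 ht.2.le) ht.1.le (by ring)
    have hp : h (z + t • (w - z)) ≤ (((1 - t) * a + t * b : ℝ) : EReal) := by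
      rw [show z + t • (w - z) = (1 - t) • z + t • w by module]
      exact hmem
    have h3 := (hmin (z + t • (w - z))).trans (add_le_add_left hp _)
    rw [hza, ← EReal.coe_add, ← EReal.coe_add, EReal.coe_le_coe_iff] at h3
    simp
    linarith
  linarith

theorem IsProx.subgradient (hh : IsProperConvex h) {α : ℝ} (hα : α ≠ 0)
    {y z : EuclideanSpace ℝ (Fin d)} (hz : IsProx h α y z) :
    h z ≠ ⊤ ∧ ∀ w, h w ≠ ⊤ → (h z).toReal + inner ℝ (α⁻¹ • (y - z)) (w - z) ≤ (h w).toReal := by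
  have hφ : HasGradientAt (fun w => 1 / (2 * α) * ‖w - y‖ ^ 2) (-(α⁻¹ • (y - z))) z := by
    rw [hasGradientAt_iff_hasFDerivAt]
    refine (((hasFDerivAt_id z).sub_const y).norm_sq.const_mul (1 / (2 * α))).congr_fderiv ?_
    ext w
    simp
    field_simp
    ring
  obtain ⟨h1, h2⟩ := hh.subgradient_of_isMin hφ fun w => hz (Set.mem_univ w)
  exact ⟨h1, fun w hw => by have := h2 w hw; rw [inner_neg_left] at this; linarith⟩

theorem IsCompositeMinimizer.subgradient (hh : IsProperConvex h)
    {f : EuclideanSpace ℝ (Fin d) → ℝ} (hd : Differentiable ℝ f) {xs : EuclideanSpace ℝ (Fin d)}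
    (hxs : IsCompositeMinimizer f h xs) :
    h xs ≠ ⊤ ∧ ∀ w, h w ≠ ⊤ → (h xs).toReal - inner ℝ (gradient f xs) (w - xs) ≤ (h w).toReal :=
  hh.subgradient_of_isMin (hd xs).hasGradientAt fun w => by
    have := hxs (Set.mem_univ w)
    simpa only [Set.mem_ofPred_eq, add_comm] using this

end Subgradient

/-! ### Contraction over one restart period -/

theorem restartedSilverStep_pos {M : ℝ} (hM : 0 < M) (k t : ℕ) : 0 < restartedSilverStep M k t :=
  div_pos (by linarith [one_lt_silverStep (t % (2 ^ k - 1))]) hM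

theorem IsProximalGD.pow_mul_norm_sq_le {d k o n : ℕ} {m M : ℝ} (hM : 0 < M)
    {f : EuclideanSpace ℝ (Fin d) → ℝ} {h : EuclideanSpace ℝ (Fin d) → EReal}
    {xs : EuclideanSpace ℝ (Fin d)} {x : ℕ → EuclideanSpace ℝ (Fin d)}
    (hf : IsSmooth M f) (hfm : StrongConvexOn Set.univ m f) (hm : 0 < m) (hh : IsProperConvex h)
    (hxs : IsCompositeMinimizer f h xs) (hx : IsProximalGD f h (restartedSilverStep M k) n x)
    (hk : 1 ≤ k) (ho : 2 ^ k - 1 ∣ o) (hon : o + (2 ^ k - 1) ≤ n) :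
    silverRatio ^ k * (m / 2 * ‖x (o + (2 ^ k - 1)) - xs‖ ^ 2) ≤ M * ‖x o - xs‖ ^ 2 := by
  have hpos : 1 < 2 ^ k := Nat.one_lt_two_pow (by omega)
  obtain ⟨hd, hL⟩ := hf
  set α := restartedSilverStep M k
  have hα : ∀ t, 0 < α t := restartedSilverStep_pos hM k
  have hstrong := hfm.add_inner_gradient_le hd
  have hcoco := add_inner_gradient_add_le hM hd hL fun y z => by
    have := hstrong y z
    have : 0 ≤ m / 2 * ‖z - y‖ ^ 2 := by positivity
    linarith
  obtain ⟨hs_top, hs_sub⟩ := hxs.subgradient hh hd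
  -- The prox subgradient belongs to the new iterate, hence the shift by one; it is needed as a
  -- subgradient only for `o < i < o + 2 ^ k`.
  let v : ℕ → EuclideanSpace ℝ (Fin d) := fun i =>
    (α (i - 1))⁻¹ • (x (i - 1) - α (i - 1) • gradient f (x (i - 1)) - x i)
  have hv : ∀ i, o < i → i < o + 2 ^ k → h (x i) ≠ ⊤ ∧ ∀ w, h w ≠ ⊤ →
      (h (x i)).toReal + inner ℝ (v i) (w - x i) ≤ (h w).toReal := fun i hi1 hi2 => by
    have := hx (i - 1) (by omega)
    rw [Nat.sub_add_cancel (by omega)] at this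
    exact this.subgradient hh (hα _).ne'
  have hdiv : ∀ {a b c q : ℝ}, a + b + q / (2 * M) ≤ c →
      a / M + b / M + q / M ^ 2 / 2 ≤ c / M := fun {a b c q} habc => by
    have : a / M + b / M + q / M ^ 2 / 2 = (a + b + q / (2 * M)) / M := by field_simp
    rw [this]
    exact div_le_div_of_nonneg_right habc hM.le
  have hQ : ∀ y z, f z / M + inner ℝ (M⁻¹ • gradient f z) (y - z) +
      ‖M⁻¹ • gradient f y - M⁻¹ • gradient f z‖ ^ 2 / 2 ≤ f y / M := fun y z => by
    rw [← smul_sub, norm_smul, real_inner_smul_left, mul_pow, Real.norm_of_nonneg (by positivity),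
      inv_pow, ← div_eq_inv_mul, ← div_eq_inv_mul]
    exact hdiv (hcoco z y)
  have hPdiv : ∀ {a c : ℝ} {y z}, a + inner ℝ y z ≤ c →
      a / M + inner ℝ (M⁻¹ • y) (z : EuclideanSpace ℝ (Fin d)) ≤ c / M := fun {a c y z} hac => by
    rw [real_inner_smul_left, ← div_eq_inv_mul, ← add_div]
    exact div_le_div_of_nonneg_right hac hM.le
  have main := IsSilverBlock.objective_le (o := o) (x := x) (g := fun i => M⁻¹ • gradient f (x i))
    (s := fun i => M⁻¹ • v i) (f := fun i => f (x i) / M) (h := fun i => (h (x i)).toReal / M)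
    (xr := xs) (gr := M⁻¹ • gradient f xs) (fr := f xs / M) (hr := (h xs).toReal / M) hk
    (fun t ht => by
      -- The block starts at a multiple of the period, so the schedule is read from its beginning.
      have hαt : α (o + t) = silverStep t / M := by
        obtain ⟨c, rfl⟩ := ho
        simp only [α, restartedSilverStep, Nat.mul_add_mod, Nat.mod_eq_of_lt ht]
      have hne := (one_lt_silverStep t).trans' one_pos
      simp only [v, Nat.add_sub_cancel, hαt]
      match_scalars <;> field_simp <;> ring)
    (fun i j => hQ _ _)
    (fun i j hi hi' hj hj' => hPdiv ((hv j hj hj').2 _ (hv i hi hi').1))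
    (fun i => hQ _ _) (fun i hi hi' => hPdiv ((hv i hi hi').2 _ hs_top))
  set y := x (o + (2 ^ k - 1))
  have h1 := hstrong xs y
  have h2 := hs_sub y (hv _ (by omega) (by omega)).1
  have h3 : m / 2 * ‖y - xs‖ ^ 2 ≤ f y + (h y).toReal - (f xs + (h xs).toReal) := by linarith
  have h4 := mul_le_mul_of_nonneg_left h3 (pow_nonneg silverRatio_pos.le k)
  have h5 : f y / M + (h y).toReal / M - (f xs / M + (h xs).toReal / M) =
      (f y + (h y).toReal - (f xs + (h xs).toReal)) / M := by ring
  rw [h5, mul_div_assoc', div_le_iff₀ hM] at main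
  linarith

theorem IsProximalGD.norm_le_two_pow_mul {d k : ℕ} {m M : ℝ} (hm : 0 < m) (hM : 0 < M)
    {f : EuclideanSpace ℝ (Fin d) → ℝ} {h : EuclideanSpace ℝ (Fin d) → EReal}
    {xs : EuclideanSpace ℝ (Fin d)} {x : ℕ → EuclideanSpace ℝ (Fin d)}
    (hf : IsSmooth M f) (hfm : StrongConvexOn Set.univ m f) (hh : IsProperConvex h)
    (hxs : IsCompositeMinimizer f h xs) (hk : 1 ≤ k) (hκ : 8 * (M / m) ≤ silverRatio ^ k) {e N : ℕ}
    (heN : e ≤ N)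
    (hx : IsProximalGD f h (restartedSilverStep M k) ((2 ^ k - 1) * N) x) :
    2 ^ e * ‖x ((2 ^ k - 1) * e) - xs‖ ≤ ‖x 0 - xs‖ := by
  induction e with
  | zero => simp
  | succ e ih =>
    refine le_trans ?_ (ih (by omega))
    have hle : (2 ^ k - 1) * e + (2 ^ k - 1) ≤ (2 ^ k - 1) * N := by
      rw [← Nat.mul_succ]; exact Nat.mul_le_mul_left _ heN
    have := hx.pow_mul_norm_sq_le hM hf hfm hm hh hxs hk (dvd_mul_right _ e) hle
    rw [← Nat.mul_succ] at this
    rw [pow_succ, mul_assoc]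
    refine mul_le_mul_of_nonneg_left ?_ (by positivity)
    set a := ‖x ((2 ^ k - 1) * e.succ) - xs‖ with ha
    have hκ' : 8 * M ≤ silverRatio ^ k * m := by
      rwa [← mul_div_assoc, div_le_iff₀ hm] at hκ
    refine le_of_sq_le_sq ?_ (norm_nonneg _)
    nlinarith [mul_le_mul_of_nonneg_right hκ' (sq_nonneg a)]

/-! ### Choice of the restart length and of the number of restarts -/

theorem exists_silverRatio_pow {κ : ℝ} (hκ : 1 ≤ κ) :
    ∃ k : ℕ, 1 ≤ k ∧ 8 * κ ≤ silverRatio ^ k ∧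
      (2 : ℝ) ^ k ≤ 2 * 8 ^ Real.logb silverRatio 2 * κ ^ Real.logb silverRatio 2 := by
  have hρ1 : 1 < silverRatio := by linarith [two_lt_silverRatio]
  -- Here `ρ ^ k ≤ 8 κ < ρ ^ (k + 1)`; the exponent used is `k + 1`, which costs the factor `2`.
  obtain ⟨k, hk1, hk2⟩ := exists_nat_pow_near (show 1 ≤ 8 * κ by linarith) hρ1
  refine ⟨k + 1, by omega, hk2.le, ?_⟩
  have h2 : (2 : ℝ) ^ k = (silverRatio ^ k) ^ Real.logb silverRatio 2 := by
    rw [← Real.rpow_natCast silverRatio, ← Real.rpow_mul silverRatio_pos.le, mul_comm,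
      Real.rpow_mul silverRatio_pos.le, Real.rpow_logb silverRatio_pos hρ1.ne' two_pos,
      Real.rpow_natCast]
  have h3 := Real.rpow_le_rpow (pow_nonneg silverRatio_pos.le k) hk1
    (Real.logb_nonneg hρ1 one_le_two)
  rw [← h2, Real.mul_rpow (by norm_num) (by linarith)] at h3
  rw [pow_succ]
  linarith

theorem exists_nat_mul_le {R ε : ℝ} (hR : 0 ≤ R) (hε : 0 < ε) :
    ∃ N : ℕ, (N : ℝ) ≤ 3 * max 1 (Real.log (R / ε)) ∧ R ≤ 2 ^ N * ε := by
  -- The constant `3` is `2`, from `1 / log 2 ≤ 2`, plus `1` for rounding up; a negative logarithm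
  -- gives `0` periods.
  refine ⟨⌈Real.log (R / ε) / Real.log 2⌉₊, ?_, ?_⟩
  · have hlog := Real.log_two_gt_d9
    have h1 : (1 : ℝ) ≤ max 1 (Real.log (R / ε)) := le_max_left _ _
    have h2 := le_max_right 1 (Real.log (R / ε))
    have h3 : Real.log (R / ε) / Real.log 2 ≤ 2 * max 1 (Real.log (R / ε)) := by
      rw [div_le_iff₀ (by linarith)]
      nlinarith
    rcases le_total (Real.log (R / ε) / Real.log 2) 0 with h4 | h4
    · rw [Nat.ceil_eq_zero.2 h4]
      push_cast
      linarith
    · linarith [Nat.ceil_lt_add_one h4]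
  · rcases hR.eq_or_lt with rfl | hR
    · positivity
    have h1 := Nat.le_ceil (Real.log (R / ε) / Real.log 2)
    rw [div_le_iff₀ (Real.log_pos one_lt_two), ← Real.log_pow,
      Real.log_le_log_iff (by positivity) (by positivity), div_le_iff₀ hε] at h1
    exact h1

theorem corollary3 :
    ∃ C : ℝ, 0 < C ∧
      ∀ m M : ℝ, 0 < m → m ≤ M →
        ∃ k : ℕ, 1 ≤ k ∧ (∀ t, 0 < restartedSilverStep M k t) ∧
          ∀ R ε : ℝ, 0 ≤ R → 0 < ε →
            ∃ n : ℕ,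
              (n : ℝ) ≤ C * (M / m) ^ Real.logb silverRatio 2 * max 1 (Real.log (R / ε)) ∧
              ∀ (d : ℕ) (f : EuclideanSpace ℝ (Fin d) → ℝ)
                (h : EuclideanSpace ℝ (Fin d) → EReal)
                (xs : EuclideanSpace ℝ (Fin d)) (x : ℕ → EuclideanSpace ℝ (Fin d)),
                IsSmooth M f → StrongConvexOn Set.univ m f → IsProperConvex h →
                IsCompositeMinimizer f h xs →
                IsProximalGD f h (restartedSilverStep M k) n x →
                ‖x 0 - xs‖ ≤ R → ‖x n - xs‖ ≤ ε := by
  refine ⟨2 * 8 ^ Real.logb silverRatio 2 * 3, by positivity, fun m M hm hmM => ?_⟩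
  have hM := hm.trans_le hmM
  obtain ⟨k, hk, hκ, h2k⟩ := exists_silverRatio_pow ((one_le_div hm).2 hmM)
  refine ⟨k, hk, restartedSilverStep_pos hM k, fun R ε hR hε => ?_⟩
  obtain ⟨N, hN, hRN⟩ := exists_nat_mul_le hR hε
  refine ⟨(2 ^ k - 1) * N, ?_, fun d f h xs x hf hfm hh hxs hx hx0 => ?_⟩
  · have h1 : (((2 ^ k - 1 : ℕ)) : ℝ) ≤ 2 ^ k := by
      exact_mod_cast Nat.sub_le (2 ^ k) 1
    calc (((2 ^ k - 1) * N : ℕ) : ℝ) = ((2 ^ k - 1 : ℕ) : ℝ) * N := by push_cast; rfl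
      _ ≤ (2 * 8 ^ Real.logb silverRatio 2 * (M / m) ^ Real.logb silverRatio 2) *
          (3 * max 1 (Real.log (R / ε))) :=
        mul_le_mul (h1.trans h2k) hN (Nat.cast_nonneg _) (by positivity)
      _ = _ := by ring
  · have := hx.norm_le_two_pow_mul hm hM hf hfm hh hxs hk hκ le_rfl
    exact le_of_mul_le_mul_left (this.trans (hx0.trans hRN)) (by positivity)
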